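/- Let $P\in[0,1]^{n\times n}$ be the symmetric adjacency matrix ($P=P^\top$, $P_{ii}=0$ for all $i$) of an undirected network, let $b\in\mathbb R^n$ and let $a\in\mathbb R\setminus\{0\}$ be such that $a\lambda<1$ for every eigenvalue $\lambda$ of $P+P^\top$. Consider the unconstrained pseudo-gradient dynamics $$\dot x(t)=(-I+aP)x(t)+b+u(t)$$ under the adaptive feedback intervention $u(t)=K(t)x(t)$, where, with $e(t):=x(t)-z(t)-w(t)$, $$\dot z(t)=-z(t)+K(t)x(t)+b+u(t),\qquad \dot w(t)=-w(t)+e(t)x(t)^\top x(t),\qquad \dot K(t)=e(t)x(t)^\top .$$ Then all solutions of this closed-loop system are bounded: for every $T\in(0,\infty]$ and every solution $(x,z,w,K):[0,T)\to\mathbb R^n\times\mathbb R^n\times\mathbb R^n\times\mathbb R^{n\times n}$, with arbitrary initial condition, there is a constant $C$ such that $\|x(t)\|\le C$, $\|z(t)\|\le C$, $\|w(t)\|\le C$ and $\|K(t)\|_{\mathrm F}\le C$ for all $t\in[0,T)$, where $\|\cdot\|$ is the Euclidean and $\|\cdot\|_{\mathrm F}$ the Frobenius norm. -/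

import Mathlib

/-- `P` is the (weighted) adjacency matrix of a network without self loops. -/
structure IsAdjacency {n : ℕ} (P : Matrix (Fin n) (Fin n) ℝ) : Prop where
  mem_Icc : ∀ i j, P i j ∈ Set.Icc (0 : ℝ) 1
  diag_eq_zero : ∀ i, P i i = 0

/-- Right-hand side `(-I + aP) x + b + u` of the unconstrained pseudo-gradient dynamics. -/
noncomputable def pseudoGradient {n : ℕ} (P : Matrix (Fin n) (Fin n) ℝ) (a : ℝ)
    (b x u : EuclideanSpace ℝ (Fin n)) : EuclideanSpace ℝ (Fin n) :=
  Matrix.toEuclideanLin (-1 + a • P) x + b + u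

/-- The Frobenius norm `√(Tr(Mᵀ M))`. -/
noncomputable def frobeniusNorm {n : ℕ} (M : Matrix (Fin n) (Fin n) ℝ) : ℝ :=
  Real.sqrt (Matrix.trace (M.transpose * M))

/-- The signals `x, z, w : [0, T) → ℝⁿ` and `K : [0, T) → ℝⁿˣⁿ`, with `0 < T ≤ ∞`, form a solution
of the pseudo-gradient dynamics in closed loop with the adaptive feedback intervention `u = K x`.
Derivatives are two-sided on `(0, T)` and one-sided at `0`; the values of the signals outside
`[0, T)` are irrelevant. Here `u` and `e` are the intervention and the error signal. -/
structure IsClosedLoopSolution {n : ℕ} (P : Matrix (Fin n) (Fin n) ℝ) (a : ℝ)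
    (b : EuclideanSpace ℝ (Fin n)) (T : EReal)
    (x z w : ℝ → EuclideanSpace ℝ (Fin n)) (K : ℝ → Matrix (Fin n) (Fin n) ℝ)
    (u e : ℝ → EuclideanSpace ℝ (Fin n)) : Prop where
  input_eq : ∀ t : ℝ, 0 ≤ t → (t : EReal) < T → u t = Matrix.toEuclideanLin (K t) (x t)
  error_eq : ∀ t : ℝ, 0 ≤ t → (t : EReal) < T → e t = x t - z t - w t
  deriv_x : ∀ t : ℝ, 0 ≤ t → (t : EReal) < T →
    HasDerivWithinAt x (pseudoGradient P a b (x t) (u t)) (Set.Ici 0) t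
  deriv_z : ∀ t : ℝ, 0 ≤ t → (t : EReal) < T →
    HasDerivWithinAt z (-z t + Matrix.toEuclideanLin (K t) (x t) + b + u t) (Set.Ici 0) t
  deriv_w : ∀ t : ℝ, 0 ≤ t → (t : EReal) < T →
    HasDerivWithinAt w (-w t + inner ℝ (x t) (x t) • e t) (Set.Ici 0) t
  deriv_K : ∀ t : ℝ, 0 ≤ t → (t : EReal) < T → ∀ i j : Fin n,
    HasDerivWithinAt (fun s => K s i j) (e t i * x t j) (Set.Ici 0) t

/-!
Write `e = x - z - w` and `K̃ = K - aP`. Subtracting the equations, `e` and `K̃` solve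
`e' = -e - K̃x - ‖x‖² e` and `K̃' = e xᵀ`, so the cross terms cancel in
`V = (‖e‖² + ‖K̃‖²) / 2`, and `V' = -‖e‖² - (‖x‖ ‖e‖)²`. Hence `e` and `K` are bounded, and
`(‖x‖ ‖e‖)²` is dominated by `-V'`.

The signal `K̃x` in `x' = (-1 + 2aP)x + b + K̃x` need not be small, but the equation of `e` expresses
it through `e'`. So `y = x + e` satisfies `y' = (-1 + 2aP)x + b - e - ‖x‖² e`. By the hypothesis on
the eigenvalues, `-1 + 2aP ≤ -α` for some `α > 0` (`exists_coercive_of_eigenvalues_lt_one`). The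
perturbation `‖x‖² e` has size at most `(‖y‖ + ‖e‖) ‖x‖ ‖e‖`, and by Young's inequality its only
harmful effect on `‖y‖²` is the growth rate `k (‖x‖ ‖e‖)²`, which the weight `exp (k V)` absorbs:
`U = ‖y‖² exp (k V)` satisfies `U' ≤ -α U + C` (`weighted_energy_rate_le`). Since `V ≥ 0`, this bounds
`y`, hence `x`. Finally `w` solves a stable linear equation with the bounded input `‖x‖² e`, and
`z = x - w - e`.
-/

open Matrix

/-! ### Scalar differential inequalities -/

lemma le_of_hasDerivWithinAt_nonpos {f f' : ℝ → ℝ} {τ : ℝ} (hτ : 0 ≤ τ)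
    (hf : ∀ t ∈ Set.Icc 0 τ, HasDerivWithinAt f (f' t) (Set.Ici 0) t)
    (hf' : ∀ t ∈ Set.Icc 0 τ, f' t ≤ 0) : f τ ≤ f 0 := by
  refine antitoneOn_of_hasDerivWithinAt_nonpos (convex_Icc 0 τ) (f' := f')
    (fun t ht => ((hf t ht).continuousWithinAt).mono Set.Icc_subset_Ici_self)
    (fun t ht => ?_) (fun t ht => hf' t (interior_subset ht))
    (Set.left_mem_Icc.2 hτ) (Set.right_mem_Icc.2 hτ) hτ
  exact (hf t (interior_subset ht)).mono (interior_subset.trans Set.Icc_subset_Ici_self)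

lemma le_max_of_hasDerivWithinAt_le {f f' : ℝ → ℝ} {τ α C : ℝ} (hτ : 0 ≤ τ) (hα : 0 < α)
    (hf : ∀ t ∈ Set.Icc 0 τ, HasDerivWithinAt f (f' t) (Set.Ici 0) t)
    (hf' : ∀ t ∈ Set.Icc 0 τ, f' t ≤ -α * f t + C) : f τ ≤ max (f 0) (C / α) := by
  have key := le_of_hasDerivWithinAt_nonpos
    (f := fun t => (f t - C / α) * Real.exp (α * t))
    (f' := fun t => f' t * Real.exp (α * t) + (f t - C / α) * (Real.exp (α * t) * (α * 1))) hτ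
    (fun t ht => ((hf t ht).sub_const _).mul
      (((hasDerivWithinAt_id t _).const_mul α).exp))
    (fun t ht => by
      have h1 := hf' t ht
      have h2 : f' t + (f t - C / α) * α ≤ 0 := by
        have : C / α * α = C := div_mul_cancel₀ C hα.ne'
        linarith
      nlinarith [Real.exp_pos (α * t)])
  simp only [mul_zero, Real.exp_zero, mul_one] at key
  have hexp : 1 ≤ Real.exp (α * τ) := Real.one_le_exp (by positivity)
  by_contra! h
  obtain ⟨h0, hC⟩ := max_lt_iff.1 h
  nlinarith

/-! ### Linear algebra -/

lemma exists_coercive_of_posDef {n : ℕ} {M : Matrix (Fin n) (Fin n) ℝ} (hM : M.PosDef) :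
    ∃ α : ℝ, 0 < α ∧ ∀ v : EuclideanSpace ℝ (Fin n),
      α * ‖v‖ ^ 2 ≤ inner ℝ v (toEuclideanLin M v) := by
  have hcont : Continuous fun v : EuclideanSpace ℝ (Fin n) => inner ℝ v (toEuclideanLin M v) :=
    continuous_id.inner (LinearMap.continuous_of_finiteDimensional _)
  have hpos : ∀ v : EuclideanSpace ℝ (Fin n), v ≠ 0 → 0 < inner ℝ v (toEuclideanLin M v) := by
    intro v hv
    have := hM.dotProduct_mulVec_pos (x := v.ofLp) (by simpa using hv)
    rw [EuclideanSpace.inner_eq_star_dotProduct, dotProduct_comm]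
    simpa [toEuclideanLin] using this
  obtain ⟨α, hα, h⟩ := (isCompact_sphere (0 : EuclideanSpace ℝ (Fin n)) 1).exists_forall_le'
    (a := 0) hcont.continuousOn (fun v hv => hpos v (by rintro rfl; simp at hv))
  refine ⟨α, hα, fun v => ?_⟩
  rcases eq_or_ne v 0 with rfl | hv
  · simp
  have hv' : ‖v‖ ≠ 0 := norm_ne_zero_iff.2 hv
  have := h (‖v‖⁻¹ • v) (by simp [norm_smul, hv'])
  rw [map_smul, real_inner_smul_left, real_inner_smul_right] at this
  calc α * ‖v‖ ^ 2 ≤ (‖v‖⁻¹ * (‖v‖⁻¹ * inner ℝ v (toEuclideanLin M v))) * ‖v‖ ^ 2 := by gcongr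
    _ = _ := by field_simp

/-- The eigenvalue condition makes `1 - a (P + Pᵀ)` coercive, whatever the sign of `a`. -/
lemma exists_coercive_of_eigenvalues_lt_one {n : ℕ} (P : Matrix (Fin n) (Fin n) ℝ) {a : ℝ}
    (ha : a ≠ 0)
    (hopt : ∀ μ : ℝ, Module.End.HasEigenvalue (toLin' (P + Pᵀ)) μ → a * μ < 1) :
    ∃ α : ℝ, 0 < α ∧ ∀ v : EuclideanSpace ℝ (Fin n),
      α * ‖v‖ ^ 2 ≤ inner ℝ v (toEuclideanLin (1 - a • (P + Pᵀ)) v) := by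
  apply exists_coercive_of_posDef
  have hH : (1 - a • (P + Pᵀ)).IsHermitian := by
    ext i j
    simp [Matrix.one_apply, eq_comm, add_comm]
  rw [hH.posDef_iff_eigenvalues_pos]
  intro i
  set μ := hH.eigenvalues i
  have hv := hH.mulVec_eigenvectorBasis i
  have hne : (hH.eigenvectorBasis i).ofLp ≠ 0 := by
    simpa using hH.eigenvectorBasis.orthonormal.ne_zero i
  set v := (hH.eigenvectorBasis i).ofLp
  have hv' : v - a • (P + Pᵀ) *ᵥ v = μ • v := by
    rw [sub_mulVec, one_mulVec, smul_mulVec] at hv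
    exact hv
  have hav : a • (P + Pᵀ) *ᵥ v = (1 - μ) • v := by
    rw [sub_smul, one_smul, ← hv']; abel
  have heig : (P + Pᵀ) *ᵥ v = ((1 - μ) / a) • v := by
    rw [div_eq_inv_mul, mul_smul, ← hav, inv_smul_smul₀ ha]
  have := hopt _ (Module.End.hasEigenvalue_of_hasEigenvector
    (x := v) (Module.End.hasEigenvector_iff.2 ⟨Module.End.mem_eigenspace_iff.2 (by
      rw [toLin'_apply, heig]), hne⟩))
  rw [mul_div_cancel₀ _ ha] at this
  linarith

lemma trace_transpose_mul_self {n : ℕ} (M : Matrix (Fin n) (Fin n) ℝ) :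
    (Mᵀ * M).trace = ∑ i, ∑ j, M i j ^ 2 := by
  simp only [trace, diag_apply, mul_apply, transpose_apply, ← sq]
  exact Finset.sum_comm

lemma inner_toEuclideanLin_eq_sum {n : ℕ} (M : Matrix (Fin n) (Fin n) ℝ)
    (v x : EuclideanSpace ℝ (Fin n)) :
    inner ℝ v (toEuclideanLin M x) = ∑ i, ∑ j, M i j * (v i * x j) := by
  simp only [PiLp.inner_apply, toEuclideanLin, toLpLin_apply, mulVec, dotProduct,
    RCLike.inner_apply, conj_trivial, Finset.sum_mul]
  exact Finset.sum_congr rfl fun i _ => Finset.sum_congr rfl fun j _ => by ring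

/-! ### The dissipated energy -/

/-- The Lyapunov function `V` of the adaptation error, as a function of the error `e` and of the
matrix mismatch `M = K - aP`. -/
noncomputable def adaptationEnergy {n : ℕ} (e : EuclideanSpace ℝ (Fin n))
    (M : Matrix (Fin n) (Fin n) ℝ) : ℝ :=
  (‖e‖ ^ 2 + ∑ i, ∑ j, M i j ^ 2) / 2

lemma norm_sq_le_adaptationEnergy {n : ℕ} (e : EuclideanSpace ℝ (Fin n))
    (M : Matrix (Fin n) (Fin n) ℝ) : ‖e‖ ^ 2 ≤ 2 * adaptationEnergy e M := by
  have : 0 ≤ ∑ i, ∑ j, M i j ^ 2 := by positivity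
  unfold adaptationEnergy
  linarith

lemma sum_sq_le_adaptationEnergy {n : ℕ} (e : EuclideanSpace ℝ (Fin n))
    (M : Matrix (Fin n) (Fin n) ℝ) : ∑ i, ∑ j, M i j ^ 2 ≤ 2 * adaptationEnergy e M := by
  have : 0 ≤ ‖e‖ ^ 2 := by positivity
  unfold adaptationEnergy
  linarith

lemma adaptationEnergy_nonneg {n : ℕ} (e : EuclideanSpace ℝ (Fin n))
    (M : Matrix (Fin n) (Fin n) ℝ) : 0 ≤ adaptationEnergy e M := by
  unfold adaptationEnergy
  positivity

/-- The adaptation law `M' = e xᵀ` is chosen to cancel the indefinite term `⟪e, M x⟫`. -/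
lemma hasDerivWithinAt_adaptationEnergy {n : ℕ} {e : ℝ → EuclideanSpace ℝ (Fin n)}
    {M : ℝ → Matrix (Fin n) (Fin n) ℝ} {x : EuclideanSpace ℝ (Fin n)} {s : Set ℝ} {t : ℝ}
    (he : HasDerivWithinAt e (-e t - toEuclideanLin (M t) x - ‖x‖ ^ 2 • e t) s t)
    (hM : ∀ i j, HasDerivWithinAt (fun r => M r i j) (e t i * x j) s t) :
    HasDerivWithinAt (fun r => adaptationEnergy (e r) (M r))
      (-(‖e t‖ ^ 2 + (‖x‖ * ‖e t‖) ^ 2)) s t := by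
  have hsum := HasDerivWithinAt.fun_sum (u := Finset.univ) fun i _ =>
    HasDerivWithinAt.fun_sum (u := Finset.univ) fun j _ => (hM i j).pow 2
  refine ((he.norm_sq.add hsum).div_const 2).congr_deriv ?_
  have hcross : ∑ i, ∑ j, (2 : ℕ) * M t i j ^ (2 - 1) * (e t i * x j) =
      2 * inner ℝ (e t) (toEuclideanLin (M t) x) := by
    simp only [inner_toEuclideanLin_eq_sum, Finset.mul_sum]
    exact Finset.sum_congr rfl fun i _ => Finset.sum_congr rfl fun j _ => by simp; ring
  rw [hcross, inner_sub_right, inner_sub_right, inner_neg_right, real_inner_smul_right,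
    real_inner_self_eq_norm_sq]
  ring

/-! ### The weighted energy of the shifted state -/

/-- The derivative of `‖x + e‖²`, diminished by the decay `k (‖x‖ ‖e‖)²` that a weight `exp (k V)`
contributes, where `A` is the negative of the system matrix. -/
lemma weighted_energy_rate_le {E : Type*} [NormedAddCommGroup E] [InnerProductSpace ℝ E]
    {α D R : ℝ} (hα : 0 < α) (A : E →ₗ[ℝ] E) (hA : ∀ v, α * ‖v‖ ^ 2 ≤ inner ℝ v (A v))
    (b x e : E) (he : ‖e‖ ≤ R) (hD : ‖b + A e - e‖ ≤ D) :
    2 * inner ℝ (x + e) (-A x + b - e - ‖x‖ ^ 2 • e)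
        - (2 / α + 1) * (‖x‖ * ‖e‖) ^ 2 * ‖x + e‖ ^ 2
      ≤ -α * ‖x + e‖ ^ 2 + (2 / α * D ^ 2 + R ^ 2) := by
  set y := x + e with hy
  have hsplit : -A x + b - e - ‖x‖ ^ 2 • e = -A y + (b + A e - e) - ‖x‖ ^ 2 • e := by
    rw [hy, map_add]; abel
  rw [hsplit, inner_sub_right, inner_add_right, inner_neg_right, real_inner_smul_right]
  set g := ‖x‖ * ‖e‖ with hg
  have hg0 : 0 ≤ g := by positivity
  have hdrift : inner ℝ y (b + A e - e) ≤ ‖y‖ * D :=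
    (real_inner_le_norm _ _).trans (by gcongr)
  have hx : ‖x‖ ≤ ‖y‖ + ‖e‖ := by
    calc ‖x‖ = ‖y - e‖ := by rw [hy, add_sub_cancel_right]
      _ ≤ _ := norm_sub_le _ _
  have hpert : -(‖x‖ ^ 2 * inner ℝ y e) ≤ ‖y‖ ^ 2 * g + ‖y‖ * ‖e‖ * g := by
    calc -(‖x‖ ^ 2 * inner ℝ y e) ≤ ‖x‖ ^ 2 * (‖y‖ * ‖e‖) := by
          nlinarith [(abs_le.1 (abs_real_inner_le_norm y e)).1, sq_nonneg ‖x‖]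
      _ = ‖x‖ * (‖y‖ * g) := by rw [hg]; ring
      _ ≤ (‖y‖ + ‖e‖) * (‖y‖ * g) := by gcongr
      _ = _ := by ring
  -- Young's inequality with weights chosen to cost `α / 2` of the decay rate each.
  have young : ∀ p q : ℝ, 2 * (p * q) ≤ α / 2 * p ^ 2 + 2 / α * q ^ 2 := by
    intro p q
    have : α / 2 * p ^ 2 + 2 / α * q ^ 2 - 2 * (p * q) = (α * p - 2 * q) ^ 2 / (2 * α) := by
      field_simp; ring
    have : 0 ≤ (α * p - 2 * q) ^ 2 / (2 * α) := by positivity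
    linarith
  have h1 := young ‖y‖ D
  have h2 := young ‖y‖ (g * ‖y‖)
  have h3 : 2 * (‖y‖ * ‖e‖ * g) ≤ R ^ 2 + g ^ 2 * ‖y‖ ^ 2 := by
    have : ‖e‖ ^ 2 ≤ R ^ 2 := by gcongr
    nlinarith [sq_nonneg (‖e‖ - g * ‖y‖)]
  have h4 := hA y
  have h5 : 2 / α * (g * ‖y‖) ^ 2 = 2 / α * g ^ 2 * ‖y‖ ^ 2 := by ring
  nlinarith

/-! ### Boundedness of the closed loop -/

namespace IsClosedLoopSolution

variable {n : ℕ} {P : Matrix (Fin n) (Fin n) ℝ} {a : ℝ} {b : EuclideanSpace ℝ (Fin n)} {T : EReal}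
  {x z w : ℝ → EuclideanSpace ℝ (Fin n)} {K : ℝ → Matrix (Fin n) (Fin n) ℝ}
  {u e : ℝ → EuclideanSpace ℝ (Fin n)}

lemma hasDerivWithinAt_error (h : IsClosedLoopSolution P a b T x z w K u e) {t : ℝ} (ht : 0 ≤ t)
    (htT : (t : EReal) < T) :
    HasDerivWithinAt (fun s => x s - z s - w s)
      (-(x t - z t - w t) - toEuclideanLin (K t - a • P) (x t)
        - ‖x t‖ ^ 2 • (x t - z t - w t)) (Set.Ici 0) t := by
  refine (((h.deriv_x t ht htT).sub (h.deriv_z t ht htT)).sub (h.deriv_w t ht htT)).congr_deriv ?_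
  rw [h.error_eq t ht htT, real_inner_self_eq_norm_sq, pseudoGradient]
  have hA : toEuclideanLin (-1 + a • P) (x t) = -x t + toEuclideanLin (a • P) (x t) := by
    simp [toEuclideanLin]
  rw [hA, map_sub, LinearMap.sub_apply]
  abel

/-- In the derivative of `x + e` the signal `(K - aP) x` cancels. -/
lemma hasDerivWithinAt_shifted_state (h : IsClosedLoopSolution P a b T x z w K u e)
    (hsymm : Pᵀ = P) {t : ℝ} (ht : 0 ≤ t) (htT : (t : EReal) < T) :
    HasDerivWithinAt (fun s => x s + (x s - z s - w s))
      (-toEuclideanLin (1 - a • (P + Pᵀ)) (x t) + b - (x t - z t - w t)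
        - ‖x t‖ ^ 2 • (x t - z t - w t)) (Set.Ici 0) t := by
  refine ((h.deriv_x t ht htT).add (h.hasDerivWithinAt_error ht htT)).congr_deriv ?_
  rw [pseudoGradient, h.input_eq t ht htT, hsymm]
  have h1 : toEuclideanLin (-1 + a • P) (x t) = -x t + toEuclideanLin (a • P) (x t) := by
    simp [toEuclideanLin]
  have h2 : toEuclideanLin (1 - a • (P + P)) (x t) =
      x t - (toEuclideanLin (a • P) (x t) + toEuclideanLin (a • P) (x t)) := by
    rw [smul_add]
    simp [toEuclideanLin]
  rw [h1, h2, map_sub, LinearMap.sub_apply]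
  abel

lemma hasDerivWithinAt_energy (h : IsClosedLoopSolution P a b T x z w K u e) {t : ℝ} (ht : 0 ≤ t)
    (htT : (t : EReal) < T) :
    HasDerivWithinAt (fun s => adaptationEnergy (x s - z s - w s) (K s - a • P))
      (-(‖x t - z t - w t‖ ^ 2 + (‖x t‖ * ‖x t - z t - w t‖) ^ 2)) (Set.Ici 0) t := by
  refine hasDerivWithinAt_adaptationEnergy (h.hasDerivWithinAt_error ht htT) fun i j => ?_
  rw [← h.error_eq t ht htT]
  exact (h.deriv_K t ht htT i j).sub_const _

lemma energy_le (h : IsClosedLoopSolution P a b T x z w K u e) {t : ℝ} (ht : 0 ≤ t)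
    (htT : (t : EReal) < T) :
    adaptationEnergy (x t - z t - w t) (K t - a • P)
      ≤ adaptationEnergy (x 0 - z 0 - w 0) (K 0 - a • P) :=
  le_of_hasDerivWithinAt_nonpos ht
    (fun s hs => h.hasDerivWithinAt_energy hs.1 ((EReal.coe_le_coe_iff.2 hs.2).trans_lt htT))
    (fun s _ => neg_nonpos.2 (by positivity))

lemma exists_error_bound (h : IsClosedLoopSolution P a b T x z w K u e) :
    ∃ R : ℝ, 0 ≤ R ∧ ∀ t : ℝ, 0 ≤ t → (t : EReal) < T → ‖x t - z t - w t‖ ≤ R :=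
  ⟨_, Real.sqrt_nonneg _, fun _ ht htT => Real.le_sqrt_of_sq_le
    ((norm_sq_le_adaptationEnergy _ _).trans
      (mul_le_mul_of_nonneg_left (h.energy_le ht htT) zero_le_two))⟩

lemma exists_gain_bound (h : IsClosedLoopSolution P a b T x z w K u e) :
    ∃ R : ℝ, ∀ t : ℝ, 0 ≤ t → (t : EReal) < T → frobeniusNorm (K t) ≤ R := by
  refine ⟨Real.sqrt (4 * adaptationEnergy (x 0 - z 0 - w 0) (K 0 - a • P)
    + 2 * ∑ i, ∑ j, (a * P i j) ^ 2), fun t ht htT => ?_⟩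
  rw [frobeniusNorm, trace_transpose_mul_self]
  refine Real.sqrt_le_sqrt ?_
  have h1 := (sum_sq_le_adaptationEnergy (x t - z t - w t) (K t - a • P)).trans
    (mul_le_mul_of_nonneg_left (h.energy_le ht htT) zero_le_two)
  have h2 : ∑ i, ∑ j, K t i j ^ 2 ≤
      2 * ∑ i, ∑ j, (K t - a • P) i j ^ 2 + 2 * ∑ i, ∑ j, (a * P i j) ^ 2 := by
    simp only [Finset.mul_sum, ← Finset.sum_add_distrib]
    refine Finset.sum_le_sum fun i _ => Finset.sum_le_sum fun j _ => ?_
    simp only [Matrix.sub_apply, Matrix.smul_apply, smul_eq_mul]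
    nlinarith [sq_nonneg (K t i j - 2 * (a * P i j))]
  linarith

lemma exists_state_bound (h : IsClosedLoopSolution P a b T x z w K u e) (hsymm : Pᵀ = P)
    {α : ℝ} (hα : 0 < α) (hA : ∀ v : EuclideanSpace ℝ (Fin n),
      α * ‖v‖ ^ 2 ≤ inner ℝ v (toEuclideanLin (1 - a • (P + Pᵀ)) v)) :
    ∃ R : ℝ, ∀ t : ℝ, 0 ≤ t → (t : EReal) < T → ‖x t‖ ≤ R := by
  obtain ⟨R, hR0, hR⟩ := h.exists_error_bound
  set A := toEuclideanLin (1 - a • (P + Pᵀ))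
  set D := ‖b‖ + ‖LinearMap.toContinuousLinearMap A‖ * R + R with hD
  set V := fun s => adaptationEnergy (x s - z s - w s) (K s - a • P) with hV
  set k := 2 / α + 1 with hk
  have hk0 : 0 ≤ k := by positivity
  set C := 2 / α * D ^ 2 + R ^ 2 with hC
  have hC0 : 0 ≤ C := by positivity
  set U := fun s => ‖x s + (x s - z s - w s)‖ ^ 2 * Real.exp (k * V s) with hU
  refine ⟨Real.sqrt (max (U 0) (C * Real.exp (k * V 0) / α)) + R,
    fun τ hτ hτT => ?_⟩
  have hlt : ∀ s ∈ Set.Icc 0 τ, (s : EReal) < T := fun s hs =>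
    (EReal.coe_le_coe_iff.2 hs.2).trans_lt hτT
  have hbound := le_max_of_hasDerivWithinAt_le (f := U) (C := C * Real.exp (k * V 0)) hτ hα
    (fun s hs => (h.hasDerivWithinAt_shifted_state hsymm hs.1 (hlt s hs)).norm_sq.mul
      ((h.hasDerivWithinAt_energy hs.1 (hlt s hs)).const_mul k).exp)
    (fun s hs => by
      have he := hR s hs.1 (hlt s hs)
      have hd : ‖b + A (x s - z s - w s) - (x s - z s - w s)‖ ≤ D := by
        have hop : ‖A (x s - z s - w s)‖ ≤ ‖LinearMap.toContinuousLinearMap A‖ * R :=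
          ((LinearMap.toContinuousLinearMap A).le_opNorm _).trans (by gcongr)
        exact (norm_sub_le _ _).trans (add_le_add ((norm_add_le _ _).trans (by gcongr)) he)
      have hrate := weighted_energy_rate_le hα A hA b (x s) (x s - z s - w s) he hd
      have hVs : V s ≤ V 0 := h.energy_le hs.1 (hlt s hs)
      have hexp : Real.exp (k * V s) ≤ Real.exp (k * V 0) := by gcongr
      have hpos := Real.exp_pos (k * V s)
      simp only [hU]
      set Y := ‖x s + (x s - z s - w s)‖
      set ε := ‖x s - z s - w s‖
      set g := ‖x s‖ * ε
      set I := inner ℝ (x s + (x s - z s - w s)) (-A (x s) + b - (x s - z s - w s)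
        - ‖x s‖ ^ 2 • (x s - z s - w s))
      calc 2 * I * Real.exp (k * V s)
            + Y ^ 2 * (Real.exp (k * V s) * (k * -(ε ^ 2 + g ^ 2)))
          = (2 * I - k * g ^ 2 * Y ^ 2) * Real.exp (k * V s)
            - k * ε ^ 2 * Y ^ 2 * Real.exp (k * V s) := by ring
        _ ≤ (2 * I - k * g ^ 2 * Y ^ 2) * Real.exp (k * V s) := by
            have : 0 ≤ k * ε ^ 2 * Y ^ 2 * Real.exp (k * V s) := by positivity
            linarith
        _ ≤ (-α * Y ^ 2 + C) * Real.exp (k * V s) := by gcongr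
        _ = -α * (Y ^ 2 * Real.exp (k * V s)) + C * Real.exp (k * V s) := by ring
        _ ≤ _ := by gcongr)
  have hy : ‖x τ + (x τ - z τ - w τ)‖ ^ 2 ≤ U τ :=
    le_mul_of_one_le_right (sq_nonneg _)
      (Real.one_le_exp (mul_nonneg hk0 (adaptationEnergy_nonneg _ _)))
  calc ‖x τ‖ = ‖x τ + (x τ - z τ - w τ) - (x τ - z τ - w τ)‖ := by rw [add_sub_cancel_right]
    _ ≤ ‖x τ + (x τ - z τ - w τ)‖ + ‖x τ - z τ - w τ‖ := norm_sub_le _ _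
    _ ≤ _ := add_le_add (Real.le_sqrt_of_sq_le (hy.trans hbound)) (hR τ hτ hτT)

lemma exists_filter_bound (h : IsClosedLoopSolution P a b T x z w K u e) {R S : ℝ}
    (hR : ∀ t : ℝ, 0 ≤ t → (t : EReal) < T → ‖x t - z t - w t‖ ≤ R)
    (hS : ∀ t : ℝ, 0 ≤ t → (t : EReal) < T → ‖x t‖ ≤ S) :
    ∃ R' : ℝ, ∀ t : ℝ, 0 ≤ t → (t : EReal) < T → ‖w t‖ ≤ R' := by
  refine ⟨Real.sqrt (max (‖w 0‖ ^ 2) ((S ^ 2 * R) ^ 2 / 1)), fun τ hτ hτT => ?_⟩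
  have hlt : ∀ s ∈ Set.Icc 0 τ, (s : EReal) < T := fun s hs =>
    (EReal.coe_le_coe_iff.2 hs.2).trans_lt hτT
  refine Real.le_sqrt_of_sq_le (le_max_of_hasDerivWithinAt_le (f := fun s => ‖w s‖ ^ 2) hτ one_pos
    (fun s hs => (h.deriv_w s hs.1 (hlt s hs)).norm_sq) fun s hs => ?_)
  have hin : ‖inner ℝ (x s) (x s) • e s‖ ≤ S ^ 2 * R := by
    rw [h.error_eq s hs.1 (hlt s hs), real_inner_self_eq_norm_sq, norm_smul, Real.norm_eq_abs,
      abs_of_nonneg (sq_nonneg _)]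
    have := hR s hs.1 (hlt s hs)
    have := hS s hs.1 (hlt s hs)
    gcongr
  have hcs : inner ℝ (w s) (inner ℝ (x s) (x s) • e s) ≤ ‖w s‖ * (S ^ 2 * R) :=
    (real_inner_le_norm _ _).trans (by gcongr)
  rw [inner_add_right, inner_neg_right, real_inner_self_eq_norm_sq]
  nlinarith [sq_nonneg (‖w s‖ - S ^ 2 * R)]

end IsClosedLoopSolution

theorem lemma2 {n : ℕ} (P : Matrix (Fin n) (Fin n) ℝ) (a : ℝ) (b : EuclideanSpace ℝ (Fin n))
    (hP : IsAdjacency P) (hsymm : P.transpose = P) (ha : a ≠ 0)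
    (hopt : ∀ μ : ℝ, Module.End.HasEigenvalue (Matrix.toLin' (P + P.transpose)) μ → a * μ < 1)
    (T : EReal) (hT : 0 < T)
    (x z w : ℝ → EuclideanSpace ℝ (Fin n)) (K : ℝ → Matrix (Fin n) (Fin n) ℝ)
    (u e : ℝ → EuclideanSpace ℝ (Fin n))
    (hsol : IsClosedLoopSolution P a b T x z w K u e) :
    ∃ C : ℝ, ∀ t : ℝ, 0 ≤ t → (t : EReal) < T →
      ‖x t‖ ≤ C ∧ ‖z t‖ ≤ C ∧ ‖w t‖ ≤ C ∧ frobeniusNorm (K t) ≤ C := by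
  obtain ⟨α, hα, hA⟩ := exists_coercive_of_eigenvalues_lt_one P ha hopt
  obtain ⟨R, -, hR⟩ := hsol.exists_error_bound
  obtain ⟨S, hS⟩ := hsol.exists_state_bound hsymm hα hA
  obtain ⟨Q, hQ⟩ := hsol.exists_filter_bound hR hS
  obtain ⟨G, hG⟩ := hsol.exists_gain_bound
  refine ⟨max (S + Q + R) (max (max S Q) G), fun t ht htT => ⟨?_, ?_, ?_, ?_⟩⟩
  · exact (hS t ht htT).trans (by simp)
  · refine le_max_of_le_left ?_
    calc ‖z t‖ = ‖x t - w t - (x t - z t - w t)‖ := by congr 1; abel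
      _ ≤ ‖x t‖ + ‖w t‖ + ‖x t - z t - w t‖ :=
          (norm_sub_le _ _).trans (by gcongr; exact norm_sub_le _ _)
      _ ≤ S + Q + R := add_le_add (add_le_add (hS t ht htT) (hQ t ht htT)) (hR t ht htT)
  · exact (hQ t ht htT).trans (by simp)
  · exact (hG t ht htT).trans (by simp)
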